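/- Let $G=(V,E)$ be a finite, simple, nonempty, connected graph. For $S\subseteq V$ let $I(S)$ be the union of $S$ and the set of all vertices that lie on some path of $G$ whose endpoints belong to $S$ (the interval function of the all-path convexity). A set $S\subseteq V$ is an interval set if $I(S)=V$, and the interval number $i(G)$ is the minimum cardinality of an interval set of $G$. A graph is $2$-connected if it has at least three vertices, is connected, and remains connected after the removal of any single vertex. A block of $G$ is a cut edge (together with its two ends) or a maximal $2$-connected subgraph of $G$. The block-cut tree $T_G$ has as its nodes the blocks and the cut vertices of $G$, and a block is adjacent in $T_G$ to precisely those cut vertices of $G$ that it contains. An end block of $G$ is a block that is a leaf (a node of degree $1$) of $T_G$, and $eb(G)$ denotes the number of end blocks of $G$. Then \[ i(G)=\begin{cases} 1, & \text{if } |V|=1;\\ 2, & \text{if } |V|=2 \text{ or } G \text{ is } 2\text{-connected};\\ eb(G), & \text{otherwise.} \end{cases} \] -/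

import Mathlib

namespace AllPath

variable {V : Type*}

/-- The interval function of the all-path convexity: `I(S)` is `S` together with all vertices
lying on some path of `G` whose two endpoints are in `S`. -/
def interval (G : SimpleGraph V) (S : Set V) : Set V :=
  S ∪ {v | ∃ u ∈ S, ∃ w ∈ S, ∃ p : G.Walk u w, p.IsPath ∧ v ∈ p.support}

/-- `S` is an interval set if `I(S) = V`. -/
def IsIntervalSet (G : SimpleGraph V) (S : Set V) : Prop :=
  interval G S = Set.univ

/-- The interval number `i(G)`: the size of a smallest interval set of a finite graph `G`
(`V` itself is an interval set, so the minimum exists). -/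
noncomputable def intervalNumber (G : SimpleGraph V) : ℕ :=
  sInf {k : ℕ | ∃ S : Set V, IsIntervalSet G S ∧ S.ncard = k}

/-- A finite graph is 2-connected if it has at least three vertices, is connected, and remains
connected after the removal of any one vertex. -/
def TwoConnected (G : SimpleGraph V) : Prop :=
  3 ≤ Nat.card V ∧ G.Connected ∧ ∀ v : V, (G.induce {v}ᶜ).Connected

/-- `z` is a cut vertex if some two other vertices are joined by a walk in `G` but not in
`G - z`. -/
def IsCutVertex (G : SimpleGraph V) (z : V) : Prop :=
  ∃ u w : ↥({z}ᶜ : Set V), G.Reachable (u : V) (w : V) ∧ ¬ (G.induce {z}ᶜ).Reachable u w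

/-- A block of `G` is a cut edge (with its two ends) or a maximal 2-connected subgraph. -/
def IsBlock (G : SimpleGraph V) (B : G.Subgraph) : Prop :=
  (∃ (u v : V) (h : G.Adj u v), G.IsBridge s(u, v) ∧ B = G.subgraphOfAdj h) ∨
    Maximal (fun H : G.Subgraph => TwoConnected H.coe) B

/-- The block-cut tree of `G`: its nodes are the blocks and the cut vertices of `G`, and a block
is joined to exactly the cut vertices that it contains. -/
def blockCutTree (G : SimpleGraph V) :
    SimpleGraph ({B : G.Subgraph // IsBlock G B} ⊕ {z : V // IsCutVertex G z}) :=
  SimpleGraph.fromRel fun x y => ∃ B z, x = Sum.inl B ∧ y = Sum.inr z ∧ z.1 ∈ B.1.verts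

/-- An end block is a block that is a leaf (a node with exactly one neighbour) of the block-cut
tree. -/
def IsEndBlock (G : SimpleGraph V) (B : G.Subgraph) : Prop :=
  ∃ hB : IsBlock G B, ((blockCutTree G).neighborSet (Sum.inl ⟨B, hB⟩)).ncard = 1

/-- The number `eb(G)` of end blocks of a finite graph `G`. -/
noncomputable def endBlockNumber (G : SimpleGraph V) : ℕ :=
  {B : G.Subgraph | IsEndBlock G B}.ncard

end AllPath

open SimpleGraph

namespace AllPath

variable {V : Type*} {G : SimpleGraph V}

/-! A vertex `v` outside `S` lies on a path between two members of `S` once there is a fan from `v`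
to two of them, and such a fan exists when no other single vertex separates `v` from `S`
(`exists_fan`). In a 2-connected graph nothing separates, so any two vertices form an interval set.
A connected graph on at least three vertices that is not 2-connected has a cut vertex, and then the
end blocks decide. Lower bound: a path through a non-cut vertex of an end block, with neither end
among the block's non-cut vertices, would pass its only cut vertex twice. As a non-cut vertex lies
in at most one block (`IsBlock.eq_of_mem_of_mem`), every interval set has a separate member for each
end block. Upper bound: every component of `G - x`, for a cut vertex `x`, contains the non-cut
vertices of some end block (`IsCutVertex.exists_isEndBlock`). Hence one non-cut vertex from each end
block gives a set that no single vertex separates from the rest. -/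

/-- Some walk from `u` to `w` avoids the vertex `x`. -/
def JoinedAvoiding (G : SimpleGraph V) (x u w : V) : Prop :=
  ∃ p : G.Walk u w, x ∉ p.support

namespace JoinedAvoiding

variable {x u v w : V}

theorem refl (h : u ≠ x) : JoinedAvoiding G x u u := ⟨.nil, by simpa using h.symm⟩

theorem symm (h : JoinedAvoiding G x u w) : JoinedAvoiding G x w u := by
  obtain ⟨p, hp⟩ := h
  exact ⟨p.reverse, by simpa using hp⟩

theorem trans (h : JoinedAvoiding G x u v) (h' : JoinedAvoiding G x v w) :
    JoinedAvoiding G x u w := by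
  obtain ⟨p, hp⟩ := h
  obtain ⟨q, hq⟩ := h'
  exact ⟨p.append q, by simp [hp, hq]⟩

theorem ne_left (h : JoinedAvoiding G x u w) : u ≠ x := by
  obtain ⟨p, hp⟩ := h
  rintro rfl
  exact hp p.start_mem_support

theorem ne_right (h : JoinedAvoiding G x u w) : w ≠ x := h.symm.ne_left

theorem of_adj (h : G.Adj u w) (hu : u ≠ x) (hw : w ≠ x) : JoinedAvoiding G x u w :=
  ⟨h.toWalk, by simp [hu.symm, hw.symm]⟩

theorem mono {G' : SimpleGraph V} (hle : G ≤ G') (h : JoinedAvoiding G x u w) :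
    JoinedAvoiding G' x u w := by
  obtain ⟨p, hp⟩ := h
  exact ⟨p.mapLe hle, by simpa using hp⟩

theorem of_mem_support {p : G.Walk u w} (hp : x ∉ p.support) (hv : v ∈ p.support) :
    JoinedAvoiding G x u v := by
  classical
  exact ⟨p.takeUntil v hv, fun h => hp (p.support_takeUntil_subset_support hv h)⟩

end JoinedAvoiding

/-! ### Cut vertices and 2-connectedness through avoiding walks -/

theorem reachable_induce_compl_iff {x : V} (u w : ↥({x}ᶜ : Set V)) :
    (G.induce {x}ᶜ).Reachable u w ↔ JoinedAvoiding G x u w := by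
  constructor
  · rintro ⟨p⟩
    refine ⟨p.map ⟨Subtype.val, fun h => h⟩, ?_⟩
    rw [Walk.support_map, List.mem_map]
    rintro ⟨y, -, hy⟩
    exact y.2 hy
  · rintro ⟨p, hp⟩
    exact ⟨p.induce _ fun y hy => by
      rintro rfl
      exact hp hy⟩

theorem isCutVertex_iff {z : V} (hG : G.Connected) :
    IsCutVertex G z ↔ ∃ u w, u ≠ z ∧ w ≠ z ∧ ¬ JoinedAvoiding G z u w := by
  constructor
  · rintro ⟨u, w, -, h⟩
    exact ⟨u, w, u.2, w.2, fun h' => h ((reachable_induce_compl_iff u w).2 h')⟩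
  · rintro ⟨u, w, hu, hw, h⟩
    exact ⟨⟨u, hu⟩, ⟨w, hw⟩, hG.preconnected _ _, fun h' =>
      h ((reachable_induce_compl_iff (⟨u, hu⟩ : ↥({z}ᶜ : Set V)) ⟨w, hw⟩).1 h')⟩

theorem joinedAvoiding_of_not_isCutVertex {z u w : V} (hG : G.Connected)
    (hz : ¬ IsCutVertex G z) (hu : u ≠ z) (hw : w ≠ z) : JoinedAvoiding G z u w := by
  by_contra h
  exact hz ((isCutVertex_iff hG).2 ⟨u, w, hu, hw, h⟩)

theorem twoConnected_iff [Finite V] :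
    TwoConnected G ↔ 3 ≤ Nat.card V ∧ ∀ x u w, u ≠ x → w ≠ x → JoinedAvoiding G x u w := by
  constructor
  · rintro ⟨h3, -, h⟩
    exact ⟨h3, fun x u w hu hw => (reachable_induce_compl_iff
      (⟨u, hu⟩ : ↥({x}ᶜ : Set V)) ⟨w, hw⟩).1 ((h x).preconnected _ _)⟩
  · rintro ⟨h3, h⟩
    have hex (u w : V) : ∃ x, u ≠ x ∧ w ≠ x := by
      by_contra! hc
      have : (Set.univ : Set V) ⊆ {u, w} := fun y _ => by
        by_cases hy : u = y
        · simp [hy]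
        · simp [hc y hy]
      have h2 := (Set.ncard_le_ncard this).trans (Set.ncard_insert_le _ _)
      rw [Set.ncard_univ, Set.ncard_singleton] at h2
      omega
    have : Nonempty V := (Nat.card_pos_iff.1 (by omega)).1
    refine ⟨h3, ⟨fun u w => ?_⟩, fun x => ?_⟩
    · obtain ⟨x, hu, hw⟩ := hex u w
      exact (h x u w hu hw).choose.reachable
    · obtain ⟨y, hy, -⟩ := hex x x
      have : Nonempty ↥({x}ᶜ : Set V) := ⟨⟨y, hy.symm⟩⟩
      exact ⟨fun u w => (reachable_induce_compl_iff u w).2 (h x u w u.2 w.2)⟩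

theorem joinedAvoiding_coe_iff {H : G.Subgraph} (x u w : H.verts) :
    JoinedAvoiding H.coe x u w ↔ JoinedAvoiding H.spanningCoe (x : V) u w := by
  constructor
  · rintro ⟨p, hp⟩
    refine ⟨p.map ⟨Subtype.val, fun h => h⟩, ?_⟩
    rw [Walk.support_map, List.mem_map]
    rintro ⟨y, hy, hyx⟩
    exact hp (Subtype.ext hyx ▸ hy)
  · rintro ⟨p, hp⟩
    obtain ⟨u, hu⟩ := u
    obtain ⟨w, hw⟩ := w
    dsimp only at p hp
    induction p with
    | nil => exact .refl fun h => hp (by simp [← h])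
    | @cons u v w h p ih =>
      have hv : v ∈ H.verts := H.edge_vert h.symm
      rw [Walk.support_cons, List.mem_cons, not_or] at hp
      have h' : H.coe.Adj ⟨u, hu⟩ ⟨v, hv⟩ := h
      refine .trans (.of_adj h' ?_ ?_) (ih hv hw hp.2)
      · exact fun h => hp.1 (by simp [← h])
      · exact fun h => hp.2 (by simp [← h])

theorem twoConnected_coe_iff [Finite V] {H : G.Subgraph} :
    TwoConnected H.coe ↔ 3 ≤ H.verts.ncard ∧ ∀ x ∈ H.verts, ∀ u ∈ H.verts, ∀ w ∈ H.verts,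
      u ≠ x → w ≠ x → JoinedAvoiding H.spanningCoe x u w := by
  rw [twoConnected_iff, Nat.card_coe_set_eq]
  refine and_congr_right fun _ => ?_
  simp only [joinedAvoiding_coe_iff, Subtype.forall, ne_eq, Subtype.mk.injEq]

/-! ### Fans and paths through a given vertex -/

/-- There are walks from `v` to `a` and from `v` to `b` that meet only in `v`. -/
def Fan (G : SimpleGraph V) (v a b : V) : Prop :=
  ∃ (p : G.Walk v a) (q : G.Walk v b), ∀ x ∈ p.support, x ∈ q.support → x = v

theorem Fan.symm {v a b : V} (h : Fan G v a b) : Fan G v b a := by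
  obtain ⟨p, q, h⟩ := h
  exact ⟨q, p, fun x hx hx' => h x hx' hx⟩

theorem Fan.exists_isPath {v a b : V} (h : Fan G v a b) :
    ∃ p : G.Walk a b, p.IsPath ∧ v ∈ p.support := by
  classical
  obtain ⟨p, q, h⟩ := h
  refine ⟨p.bypass.reverse.append q.bypass, ?_, by simp⟩
  have hq := q.bypass_isPath
  apply Walk.IsPath.mk'
  rw [Walk.support_append, List.nodup_append]
  refine ⟨p.bypass_isPath.reverse.support_nodup, hq.support_nodup.tail, ?_⟩
  rintro x hx _ hy rfl
  have hxv : x = v := h x (p.support_bypass_subset_support (by simpa using hx))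
    (q.support_bypass_subset_support (List.mem_of_mem_tail hy))
  subst hxv
  have hn := hq.support_nodup
  rw [← Walk.cons_tail_support, List.nodup_cons] at hn
  exact hn.1 hy

/-- Cut `p` at its last vertex in `A` and keep the rest. -/
theorem exists_walk_meeting_once {a b : V} (p : G.Walk a b) (A : Set V)
    (ha : ∃ x ∈ p.support, x ∈ A) :
    ∃ y ∈ A, ∃ q : G.Walk y b, q.support ⊆ p.support ∧ ∀ x ∈ q.support, x ∈ A → x = y := by
  induction p with
  | nil =>
    obtain ⟨x, hx, hxA⟩ := ha
    rw [Walk.support_nil, List.mem_singleton] at hx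
    subst hx
    exact ⟨_, hxA, .nil, by simp, by simp⟩
  | @cons u v w h p ih =>
    by_cases hA : ∃ x ∈ p.support, x ∈ A
    · obtain ⟨y, hy, q, hq, hqA⟩ := ih hA
      exact ⟨y, hy, q, fun x hx => by simp [hq hx], hqA⟩
    · obtain ⟨y, hy, hyA⟩ := ha
      push Not at hA
      rw [Walk.support_cons, List.mem_cons] at hy
      obtain rfl : y = u := hy.resolve_right fun hy => hA y hy hyA
      refine ⟨y, hyA, .cons h p, by simp, fun x hx hxA => ?_⟩
      rw [Walk.support_cons, List.mem_cons] at hx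
      exact hx.resolve_right fun hx => hA x hx hxA

/-- The augmentation step of `exists_fan`: the arm ending at `m` is to end in `S` instead. If `s` is
on that arm, cut it there; if `s` is on neither arm, prolong it to `s`. If `s` is on the other arm,
cut that one at `s` and take a walk to `S` avoiding `s`: from its last vertex on the fan onwards it
completes one arm, and the other arm ends at `s`. -/
theorem Fan.exists_of_adj {v s t m : V} {S : Set V} (hv : v ∉ S) (hs : s ∈ S) (ht : t ∈ S)
    (hms : G.Adj m s) (hsep : ∃ s' ∈ S, JoinedAvoiding G s v s')
    (h : Fan G v m t) : ∃ a ∈ S, ∃ b ∈ S, a ≠ b ∧ Fan G v a b := by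
  classical
  have hvs : v ≠ s := fun h => hv (h ▸ hs)
  obtain ⟨p, q, hpq⟩ := h
  by_cases hsp : s ∈ p.support
  · refine ⟨s, hs, t, ht, ?_, p.takeUntil s hsp, q, fun x hx hx' =>
      hpq x (p.support_takeUntil_subset_support hsp hx) hx'⟩
    rintro rfl
    exact hvs (hpq s hsp q.end_mem_support).symm
  by_cases hsq : s ∈ q.support
  · obtain ⟨q', hq', hpq'⟩ : ∃ q' : G.Walk v s, q'.IsPath ∧
        ∀ x ∈ p.support, x ∈ q'.support → x = v :=
      ⟨(q.takeUntil s hsq).bypass, Walk.bypass_isPath _, fun x hx hx' =>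
        hpq x hx (q.support_takeUntil_subset_support hsq
          (Walk.support_bypass_subset_support _ hx'))⟩
    obtain ⟨s', hs', r, hr⟩ := hsep
    obtain ⟨y, hy, r, hr', hrA⟩ := exists_walk_meeting_once r {x | x ∈ p.support ∨ x ∈ q'.support}
      ⟨v, by simp, by simp⟩
    replace hr : s ∉ r.support := fun h => hr (hr' h)
    have hs's : s' ≠ s := fun h => hr (h ▸ r.end_mem_support)
    have hys : y ≠ s := fun h => hr (h ▸ r.start_mem_support)
    rcases hy with hy | hy
    · refine ⟨s', hs', s, hs, hs's, (p.takeUntil y hy).append r, q', fun x hx hx' => ?_⟩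
      rw [Walk.mem_support_append_iff] at hx
      rcases hx with hx | hx
      · exact hpq' x (p.support_takeUntil_subset_support hy hx) hx'
      · obtain rfl := hrA x hx (Or.inr hx')
        exact hpq' x hy hx'
    · refine ⟨s, hs, s', hs', hs's.symm, p.concat hms, (q'.takeUntil y hy).append r,
        fun x hx hx' => ?_⟩
      rw [Walk.support_concat, List.mem_append, List.mem_singleton] at hx
      rw [Walk.mem_support_append_iff] at hx'
      rcases hx with hx | rfl
      · rcases hx' with hx' | hx'
        · exact hpq' x hx (q'.support_takeUntil_subset_support hy hx')
        · obtain rfl := hrA x hx' (Or.inl hx)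
          exact hpq' x hx hy
      · exact (hx'.elim (Walk.endpoint_notMem_support_takeUntil hq' hy hys.symm) hr).elim
  · refine ⟨s, hs, t, ht, ?_, p.concat hms, q, fun x hx hx' => ?_⟩
    · rintro rfl
      exact hsq q.end_mem_support
    · rw [Walk.support_concat, List.mem_append, List.mem_singleton] at hx
      rcases hx with hx | rfl
      · exact hpq x hx hx'
      · exact absurd hx' hsq

/-- The two-path case of Menger's fan theorem. -/
theorem exists_fan {v : V} {S : Set V} (hv : v ∉ S) (hne : S.Nonempty)
    (hreach : ∀ s ∈ S, G.Reachable v s)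
    (hsep : ∀ x, x ≠ v → ∃ s ∈ S, JoinedAvoiding G x v s) :
    ∃ a ∈ S, ∃ b ∈ S, a ≠ b ∧ Fan G v a b := by
  obtain ⟨s, hs⟩ := hne
  obtain ⟨p⟩ := (hreach s hs).symm
  clear hreach
  -- Induction along a walk from `s` to `v`: the next vertex `m` is added to the target set, which
  -- preserves the separation hypothesis, and `Fan.exists_of_adj` then trades `m` for members of
  -- `S`.
  induction p generalizing S with
  | nil => exact absurd hs hv
  | @cons s m v h p ih =>
    have hvs : s ≠ v := fun h => hv (h ▸ hs)
    by_cases hmS : m ∈ S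
    · exact ih hv hsep hmS
    by_cases hmv : m = v
    · subst hmv
      obtain ⟨s', hs', q, hq⟩ := hsep s hvs
      refine ⟨s, hs, s', hs', ?_, h.symm.toWalk, q, fun x hx hx' => ?_⟩
      · rintro rfl
        exact hq q.end_mem_support
      · simp at hx
        rcases hx with rfl | rfl
        · rfl
        · exact absurd hx' hq
    · obtain ⟨a, ha, b, hb, hab, hf⟩ := ih (S := insert m S)
        (by simp [hv, Ne.symm hmv]) (fun x hx => by
          obtain ⟨s, hs, h⟩ := hsep x hx
          exact ⟨s, Or.inr hs, h⟩) (Or.inl rfl)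
      rcases ha with rfl | ha
      · exact hf.exists_of_adj hv hs (hb.resolve_left hab.symm) h.symm (hsep s hvs)
      · rcases hb with rfl | hb
        · exact hf.symm.exists_of_adj hv hs ha h.symm (hsep s hvs)
        · exact ⟨a, ha, b, hb, hab, hf⟩

theorem exists_isPath_of_forall_joinedAvoiding {a b v : V} (hab : a ≠ b) (hva : v ≠ a)
    (hvb : v ≠ b) (ha : ∀ x, x ≠ v → x ≠ a → JoinedAvoiding G x v a)
    (hb : JoinedAvoiding G a v b) :
    ∃ p : G.Walk a b, p.IsPath ∧ v ∈ p.support := by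
  obtain ⟨c, hc, d, hd, hcd, hf⟩ := exists_fan (G := G) (v := v) (S := {a, b}) (by simp [hva, hvb])
    ⟨a, by simp⟩ (by
      rintro s (rfl | rfl)
      · exact (ha b hvb.symm hab.symm).choose.reachable
      · exact hb.choose.reachable) (fun x hx => by
      by_cases hxa : x = a
      · exact ⟨b, by simp, hxa ▸ hb⟩
      · exact ⟨a, by simp, ha x hx hxa⟩)
  rcases hc with rfl | rfl <;> rcases hd with rfl | rfl
  · exact absurd rfl hcd
  · exact hf.exists_isPath
  · exact hf.symm.exists_isPath
  · exact absurd rfl hcd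

/-! ### 2-connected subgraphs and ears -/

theorem JoinedAvoiding.of_toSubgraph_le {H : G.Subgraph} {x u w : V} {p : G.Walk u w}
    (hp : p.toSubgraph ≤ H) (hx : x ∉ p.support) : JoinedAvoiding H.spanningCoe x u w := by
  refine ⟨p.transfer H.spanningCoe fun e he => ?_, by rwa [Walk.support_transfer]⟩
  rw [← Walk.mem_edges_toSubgraph] at he
  rw [Subgraph.edgeSet_spanningCoe]
  exact Subgraph.edgeSet_mono hp he

theorem TwoConnected.joinedAvoiding [Finite V] {H : G.Subgraph} (h : TwoConnected H.coe)
    {x u w : V} (hu : u ∈ H.verts) (hw : w ∈ H.verts) (hux : u ≠ x) (hwx : w ≠ x) :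
    JoinedAvoiding H.spanningCoe x u w := by
  by_cases hx : x ∈ H.verts
  · exact (twoConnected_coe_iff.1 h).2 x hx u hu w hw hux hwx
  · obtain ⟨p⟩ := h.2.1.preconnected ⟨u, hu⟩ ⟨w, hw⟩
    refine ⟨p.map ⟨Subtype.val, fun h => h⟩, ?_⟩
    rw [Walk.support_map, List.mem_map]
    rintro ⟨y, -, hyx⟩
    exact hx (hyx ▸ y.2)

theorem TwoConnected.exists_mem_ne_ne [Finite V] {H : G.Subgraph} (h : TwoConnected H.coe)
    (u w : V) : ∃ y ∈ H.verts, y ≠ u ∧ y ≠ w := by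
  by_contra! hc
  have : H.verts ⊆ {u, w} := fun y hy => by
    by_cases hyu : y = u
    · simp [hyu]
    · simp [hc y hy hyu]
  have h2 := (Set.ncard_le_ncard this).trans (Set.ncard_insert_le _ _)
  have h3 := (twoConnected_coe_iff.1 h).1
  rw [Set.ncard_singleton] at h2
  omega

theorem toSubgraph_takeUntil_le [DecidableEq V] {a b u : V} (p : G.Walk a b)
    (hu : u ∈ p.support) : (p.takeUntil u hu).toSubgraph ≤ p.toSubgraph := by
  conv_rhs => rw [← p.take_spec hu, Walk.toSubgraph_append]
  exact le_sup_left

theorem toSubgraph_dropUntil_le [DecidableEq V] {a b u : V} (p : G.Walk a b)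
    (hu : u ∈ p.support) : (p.dropUntil u hu).toSubgraph ≤ p.toSubgraph := by
  conv_rhs => rw [← p.take_spec hu, Walk.toSubgraph_append]
  exact le_sup_right

theorem eq_of_mem_takeUntil_of_mem_dropUntil [DecidableEq V] {a b u x : V} {p : G.Walk a b}
    (hp : p.IsPath) (hu : u ∈ p.support) (hx : x ∈ (p.takeUntil u hu).support)
    (hx' : x ∈ (p.dropUntil u hu).support) : x = u := by
  by_contra hxu
  rw [← p.take_spec hu] at hp
  exact hp.ne_of_mem_support_of_append hxu hx hx' rfl

/-- Attaching an ear to a 2-connected subgraph gives a 2-connected subgraph. -/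
theorem TwoConnected.sup_toSubgraph [Finite V] {H : G.Subgraph} (h : TwoConnected H.coe)
    {a b : V} (ha : a ∈ H.verts) (hb : b ∈ H.verts) {p : G.Walk a b}
    (hp : p.IsPath) : TwoConnected (H ⊔ p.toSubgraph).coe := by
  classical
  -- A path visits `x` at most once, so from `u` one of the two directions along the ear reaches `H`
  -- without meeting `x`.
  have key {x u : V} (hu : u ∈ (H ⊔ p.toSubgraph).verts) (hux : u ≠ x) :
      ∃ y ∈ H.verts, JoinedAvoiding (H ⊔ p.toSubgraph).spanningCoe x u y := by
    rw [Subgraph.verts_sup, Set.mem_union, Walk.mem_verts_toSubgraph] at hu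
    rcases hu with hu | hu
    · exact ⟨u, hu, .refl hux⟩
    by_cases hx : x ∈ (p.takeUntil u hu).support
    · refine ⟨b, hb, .of_toSubgraph_le ((toSubgraph_dropUntil_le p hu).trans le_sup_right)
        fun hx' => hux (eq_of_mem_takeUntil_of_mem_dropUntil hp hu hx hx').symm⟩
    · exact ⟨a, ha, (JoinedAvoiding.of_toSubgraph_le
        ((toSubgraph_takeUntil_le p hu).trans le_sup_right) hx).symm⟩
  refine twoConnected_coe_iff.2 ⟨(twoConnected_coe_iff.1 h).1.trans
    (Set.ncard_le_ncard (by simp)), fun x _ u hu w hw hux hwx => ?_⟩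
  obtain ⟨y, hy, huy⟩ := key hu hux
  obtain ⟨z, hz, hwz⟩ := key hw hwx
  exact huy.trans (((h.joinedAvoiding hy hz huy.ne_right hwz.ne_right).mono
    (Subgraph.spanningCoe_le_of_le le_sup_left)).trans hwz.symm)

theorem toSubgraph_le_of_maximal [Finite V] {B : G.Subgraph}
    (hB : Maximal (fun H : G.Subgraph => TwoConnected H.coe) B) {a b : V} (ha : a ∈ B.verts)
    (hb : b ∈ B.verts) {p : G.Walk a b} (hp : p.IsPath) : p.toSubgraph ≤ B :=
  le_sup_right.trans (hB.2 (hB.1.sup_toSubgraph ha hb hp) le_sup_left)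

/-! ### Blocks at a vertex that is not a cut vertex -/

/-- Step from `v` to `w` and go on to `b` avoiding `v`: the bridge must be used, and only the first
edge meets `v`. -/
theorem eq_of_adj_of_isBridge (hG : G.Connected) {v b w : V} (hvb : G.Adj v b)
    (hbr : G.IsBridge s(v, b)) (hv : ¬ IsCutVertex G v) (hvw : G.Adj v w) : w = b := by
  obtain ⟨p, hp⟩ := joinedAvoiding_of_not_isCutVertex hG hv hvw.ne' hvb.ne'
  have := isBridge_iff_forall_walk_mem_edges.1 hbr (.cons hvw p)
  rw [Walk.edges_cons, List.mem_cons] at this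
  rcases this with h | h
  · exact (Sym2.congr_right.1 h).symm
  · exact absurd (p.fst_mem_support_of_mem_edges h) hp

/-- A block that is a cut edge, seen from one of its ends. -/
theorem exists_of_mem_subgraphOfAdj {a b v : V} {h : G.Adj a b} (hbr : G.IsBridge s(a, b))
    (hv : v ∈ (G.subgraphOfAdj h).verts) :
    ∃ (c : V) (h' : G.Adj v c), G.IsBridge s(v, c) ∧
      G.subgraphOfAdj h = G.subgraphOfAdj h' := by
  rcases hv with rfl | rfl
  · exact ⟨b, h, hbr, rfl⟩
  · exact ⟨a, h.symm, Sym2.eq_swap ▸ hbr, subgraphOfAdj_symm h.symm⟩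

/-- For a 2-connected block, the edge to `w` followed by a path that returns to the block avoiding
`v` is an ear, which maximality absorbs. -/
theorem IsBlock.adj_of_not_isCutVertex [Finite V] (hG : G.Connected) {B : G.Subgraph}
    (hB : IsBlock G B) {v w : V} (hvB : v ∈ B.verts) (hv : ¬ IsCutVertex G v)
    (hvw : G.Adj v w) : B.Adj v w := by
  rcases hB with ⟨a, b, h, hbr, rfl⟩ | hB
  · obtain ⟨c, h', hbr', heq⟩ := exists_of_mem_subgraphOfAdj hbr hvB
    obtain rfl := eq_of_adj_of_isBridge hG h' hbr' hv hvw
    rw [heq]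
    simp
  · classical
    obtain ⟨a, ha, hav, -⟩ := hB.1.exists_mem_ne_ne v v
    obtain ⟨p, hp⟩ := joinedAvoiding_of_not_isCutVertex hG hv hvw.ne' hav
    have hq : (Walk.cons hvw p.bypass).IsPath :=
      p.bypass_isPath.cons fun h => hp (p.support_bypass_subset_support h)
    exact (toSubgraph_le_of_maximal hB hvB ha hq).2 (by simp [Walk.toSubgraph])

theorem IsBlock.le_of_mem_of_mem [Finite V] (hG : G.Connected) {B C : G.Subgraph}
    (hB : IsBlock G B) (hC : IsBlock G C) {v : V} (hvB : v ∈ B.verts) (hvC : v ∈ C.verts)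
    (hv : ¬ IsCutVertex G v) : B ≤ C := by
  rcases id hB with ⟨a, b, h, hbr, rfl⟩ | hB'
  · obtain ⟨c, h', hbr', heq⟩ := exists_of_mem_subgraphOfAdj hbr hvB
    rw [heq]
    exact subgraphOfAdj_le_of_adj _ (hC.adj_of_not_isCutVertex hG hvC hv h')
  rcases id hC with ⟨a, b, h, hbr, rfl⟩ | hC'
  · obtain ⟨c, h', hbr', -⟩ := exists_of_mem_subgraphOfAdj hbr hvC
    -- A cut edge and a 2-connected block cannot share `v`: its only neighbour would be `c`, yet `B`
    -- has a walk from `v` to `x` avoiding `c`.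
    obtain ⟨x, hx, hxv, hxc⟩ := hB'.1.exists_mem_ne_ne v c
    obtain ⟨p, hp⟩ := hB'.1.joinedAvoiding hvB hx h'.ne hxc
    cases p with
    | nil => exact absurd rfl hxv
    | @cons _ n _ hvn p =>
      obtain rfl := eq_of_adj_of_isBridge hG h' hbr' hv (B.spanningCoe_le hvn)
      exact absurd (by simp) hp
  obtain ⟨a, ha, hav, -⟩ := hB'.1.exists_mem_ne_ne v v
  obtain ⟨p⟩ := hG.preconnected v a
  cases p with
  | nil => exact absurd rfl hav
  | @cons _ u _ hvu _ =>
    have huB : u ∈ B.verts := B.edge_vert (hB.adj_of_not_isCutVertex hG hvB hv hvu).symm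
    have huC : u ∈ C.verts := C.edge_vert (hC.adj_of_not_isCutVertex hG hvC hv hvu).symm
    -- Both blocks contain the neighbour `u`. Each further `w` in `B` lies on a path of `B` from `v`
    -- to `u`, which is an ear of `C`.
    have hverts : B.verts ⊆ C.verts := fun w hw => by
      by_cases hwv : w = v
      · exact hwv ▸ hvC
      by_cases hwu : w = u
      · exact hwu ▸ huC
      obtain ⟨p, hp, hwp⟩ := exists_isPath_of_forall_joinedAvoiding (G := B.spanningCoe)
        hvu.ne hwv hwu (fun x hxw hxv => hB'.1.joinedAvoiding hw hvB hxw.symm hxv.symm)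
        (hB'.1.joinedAvoiding hw huB hwv hvu.ne')
      have := toSubgraph_le_of_maximal hC' hvC huC
        ((Walk.isPath_mapLe B.spanningCoe_le).2 hp)
      exact this.1 (by simpa using hwp)
    refine ⟨hverts, fun x y hxy => ?_⟩
    have hxy' : G.Adj x y := B.adj_sub hxy
    exact (toSubgraph_le_of_maximal hC' (hverts (B.edge_vert hxy))
      (hverts (B.edge_vert hxy.symm)) (Walk.IsPath.of_adj hxy')).2 (by simp)

theorem IsBlock.eq_of_mem_of_mem [Finite V] (hG : G.Connected) {B C : G.Subgraph}
    (hB : IsBlock G B) (hC : IsBlock G C) {v : V} (hvB : v ∈ B.verts) (hvC : v ∈ C.verts)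
    (hv : ¬ IsCutVertex G v) : B = C :=
  (hB.le_of_mem_of_mem hG hC hvB hvC hv).antisymm (hC.le_of_mem_of_mem hG hB hvC hvB hv)

/-! ### End blocks and the lower bound -/

theorem isEndBlock_iff {B : G.Subgraph} :
    IsEndBlock G B ↔ IsBlock G B ∧ ∃ z ∈ B.verts, IsCutVertex G z ∧
      ∀ y ∈ B.verts, IsCutVertex G y → y = z := by
  have key (hB : IsBlock G B) : (blockCutTree G).neighborSet (Sum.inl ⟨B, hB⟩) =
      Sum.inr '' {z | z.1 ∈ B.verts} := by
    ext y
    simp only [mem_neighborSet, blockCutTree, fromRel_adj, Set.mem_image, Set.mem_ofPred_eq]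
    aesop
  constructor
  · rintro ⟨hB, h⟩
    rw [key hB, Set.ncard_image_of_injective _ Sum.inr_injective, Set.ncard_eq_one] at h
    obtain ⟨z, hz⟩ := h
    have hz' (y) : y.1 ∈ B.verts ↔ y = z := Set.ext_iff.1 hz y
    exact ⟨hB, z, (hz' z).2 rfl, z.2, fun y hy hyc => congrArg Subtype.val ((hz' ⟨y, hyc⟩).1 hy)⟩
  · rintro ⟨hB, z, hz, hzc, h⟩
    refine ⟨hB, ?_⟩
    rw [key hB, Set.ncard_image_of_injective _ Sum.inr_injective, Set.ncard_eq_one]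
    refine ⟨⟨z, hzc⟩, Set.ext fun y => ⟨fun hy => Subtype.ext (h y hy y.2), ?_⟩⟩
    rintro rfl
    exact hz

theorem IsBlock.exists_mem_ne [Finite V] {B : G.Subgraph} (hB : IsBlock G B) (z : V) :
    ∃ v ∈ B.verts, v ≠ z := by
  rcases hB with ⟨a, b, h, -, rfl⟩ | hB
  · by_cases ha : a = z
    · exact ⟨b, by simp, ha ▸ h.ne'⟩
    · exact ⟨a, by simp, ha⟩
  · obtain ⟨v, hv, hvz, -⟩ := hB.1.exists_mem_ne_ne z z
    exact ⟨v, hv, hvz⟩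

theorem IsEndBlock.exists_not_isCutVertex [Finite V] {B : G.Subgraph} (hB : IsEndBlock G B) :
    ∃ v ∈ B.verts, ¬ IsCutVertex G v := by
  obtain ⟨hB, z, -, -, hz⟩ := isEndBlock_iff.1 hB
  obtain ⟨v, hv, hvz⟩ := hB.exists_mem_ne z
  exact ⟨v, hv, fun h => hvz (hz v hv h)⟩

/-- Edges at a non-cut vertex of `B` stay in `B`, so the non-cut vertices of `B` can be left only
through `z`. -/
theorem mem_support_of_mem_of_notMem [Finite V] (hG : G.Connected) {B : G.Subgraph}
    (hB : IsBlock G B) {z : V} (hz : ∀ y ∈ B.verts, IsCutVertex G y → y = z) {v w : V}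
    (p : G.Walk v w) (hv : v ∈ B.verts) (hw : w ∈ B.verts → IsCutVertex G w) :
    z ∈ p.support := by
  induction p with
  | nil => simp [hz _ hv (hw hv)]
  | @cons v n w h p ih =>
    by_cases hvc : IsCutVertex G v
    · simp [hz v hv hvc]
    · have := ih (B.edge_vert (hB.adj_of_not_isCutVertex hG hv hvc h).symm) hw
      simp [this]

theorem IsEndBlock.exists_mem_of_isIntervalSet [Finite V] (hG : G.Connected) {B : G.Subgraph}
    (hB : IsEndBlock G B) {S : Set V} (hS : IsIntervalSet G S) :
    ∃ s ∈ S, s ∈ B.verts ∧ ¬ IsCutVertex G s := by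
  classical
  obtain ⟨v, hv, hvc⟩ := hB.exists_not_isCutVertex
  obtain ⟨hB, z, -, hzc, hz⟩ := isEndBlock_iff.1 hB
  by_contra! hc
  have hvI : v ∈ interval G S := hS ▸ Set.mem_univ v
  rcases hvI with hvS | ⟨s, hs, t, ht, p, hp, hvp⟩
  · exact hvc (hc v hvS hv)
  · have h1 := mem_support_of_mem_of_notMem hG hB hz (p.takeUntil v hvp).reverse hv (hc s hs)
    have h2 := mem_support_of_mem_of_notMem hG hB hz (p.dropUntil v hvp) hv (hc t ht)
    rw [Walk.support_reverse, List.mem_reverse] at h1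
    exact hvc (eq_of_mem_takeUntil_of_mem_dropUntil hp hvp h1 h2 ▸ hzc)

theorem endBlockNumber_le_ncard [Finite V] (hG : G.Connected) {S : Set V}
    (hS : IsIntervalSet G S) : endBlockNumber G ≤ S.ncard := by
  have := hG.nonempty
  choose! f hfS hfB hfc using fun (B : G.Subgraph) (hB : IsEndBlock G B) =>
    hB.exists_mem_of_isIntervalSet hG hS
  refine Set.ncard_le_ncard_of_injOn f (fun B hB => hfS B hB) fun B hB C hC hBC => ?_
  exact hB.1.eq_of_mem_of_mem hG hC.1 (hfB B hB) (hBC ▸ hfB C hC) (hfc B hB)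

/-! ### Components of `G - z` and the upper bound -/

/-- Until a walk from `c` first meets `y`, it stays in the component of `c` in `G - y`, which misses
`z`. -/
theorem joinedAvoiding_of_forall_ne {c y z : V} (hG : G.Connected)
    (h : ∀ w, JoinedAvoiding G y c w → w ≠ z) (hcy : c ≠ y) (hyz : y ≠ z) :
    JoinedAvoiding G z c y := by
  obtain ⟨p⟩ := hG.preconnected c y
  induction p with
  | nil => exact absurd rfl hcy
  | @cons c n y hcn p ih =>
    have hcz : c ≠ z := h c (.refl hcy)
    by_cases hny : n = y
    · exact hny ▸ .of_adj hcn hcz (hny ▸ hyz)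
    · have hcn' : JoinedAvoiding G y c n := .of_adj hcn hcy hny
      have := ih (fun w hw => h w (hcn'.trans hw)) hny hyz
      exact (JoinedAvoiding.of_adj hcn hcz this.ne_left).trans this

/-- The component of `c` in `G - z`, together with `z`. -/
def closedComponent (G : SimpleGraph V) (z c : V) : Set V :=
  insert z {w | JoinedAvoiding G z c w}

theorem joinedAvoiding_induce_closedComponent {y z c w : V} (hwz : JoinedAvoiding G y w z)
    (hcw : JoinedAvoiding G z c w) :
    JoinedAvoiding ((⊤ : G.Subgraph).induce (closedComponent G z c)).spanningCoe y w z := by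
  obtain ⟨p, hp⟩ := hwz
  induction p with
  | nil => exact absurd rfl hcw.ne_right
  | @cons w n z hwn p ih =>
    rw [Walk.support_cons, List.mem_cons, not_or] at hp
    have hw : w ∈ closedComponent G z c := Or.inr hcw
    have hny : n ≠ y := by
      rintro rfl
      exact hp.2 p.start_mem_support
    have key (hn : n ∈ closedComponent G z c) :
        JoinedAvoiding ((⊤ : G.Subgraph).induce (closedComponent G z c)).spanningCoe y w n :=
      .of_adj (by simp [hw, hn, hwn]) (Ne.symm hp.1) hny
    by_cases hnz : n = z
    · exact hnz ▸ key (Or.inl hnz)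
    · have hcn := hcw.trans (.of_adj hwn hcw.ne_right hnz)
      exact (key (Or.inr hcn)).trans (ih hcn hp.2)

theorem mem_closedComponent_of_adj {z c v w : V} (hv : JoinedAvoiding G z c v)
    (h : G.Adj v w) : w ∈ closedComponent G z c := by
  by_cases hw : w = z
  · exact Or.inl hw
  · exact Or.inr (hv.trans (.of_adj h hv.ne_right hw))

theorem joinedAvoiding_induce_self {z c w : V} (hcw : JoinedAvoiding G z c w) :
    JoinedAvoiding ((⊤ : G.Subgraph).induce (closedComponent G z c)).spanningCoe z c w := by
  obtain ⟨p, hp⟩ := hcw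
  refine .of_toSubgraph_le (p := p) ?_ hp
  refine (Walk.toSubgraph_le_induce_support p).trans (Subgraph.induce_mono_right fun x hx => ?_)
  exact Or.inr (.of_mem_support hp hx)

/-- Removing `z` leaves a component, which is connected; after removing any other vertex, not being
a cut vertex, everything is still joined to `z`. -/
theorem isBlock_induce_closedComponent [Finite V] (hG : G.Connected) {z c b : V} (hcz : c ≠ z)
    (hb : JoinedAvoiding G z c b) (hcb : c ≠ b)
    (h : ∀ y, JoinedAvoiding G z c y → ¬ IsCutVertex G y) :
    IsBlock G ((⊤ : G.Subgraph).induce (closedComponent G z c)) := by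
  set B := (⊤ : G.Subgraph).induce (closedComponent G z c) with hBdef
  have hBv : B.verts = closedComponent G z c := rfl
  have hzB : z ∈ B.verts := Or.inl rfl
  have hcB : c ∈ B.verts := Or.inr (.refl hcz)
  have hB : TwoConnected B.coe := by
    refine twoConnected_coe_iff.2 ⟨?_, fun x hx u hu w hw hux hwx => ?_⟩
    · have h3 : ({z, c, b} : Set V).ncard = 3 :=
        Set.ncard_eq_three.2 ⟨z, c, b, hcz.symm, hb.ne_right.symm, hcb, rfl⟩
      rw [← h3]
      refine Set.ncard_le_ncard ?_
      rintro x (rfl | rfl | rfl)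
      · exact hzB
      · exact hcB
      · exact Or.inr hb
    · rcases hx with rfl | hx
      · exact (joinedAvoiding_induce_self (hu.resolve_left hux)).symm.trans
          (joinedAvoiding_induce_self (hw.resolve_left hwx))
      · have key {u} (hu : u ∈ B.verts) (hux : u ≠ x) : JoinedAvoiding B.spanningCoe x u z := by
          rcases hu with rfl | hu
          · exact .refl hux
          · exact joinedAvoiding_induce_closedComponent (joinedAvoiding_of_not_isCutVertex hG
              (h x hx) hux hx.ne_right.symm) hu
        exact (key hu hux).trans (key hw hwx).symm
  -- A 2-connected `K` above `B` joins each of its vertices other than `z` to `c` avoiding `z`, so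
  -- it stays in the component.
  refine Or.inr ⟨hB, fun K hK hBK => ?_⟩
  have hverts : K.verts ⊆ B.verts := fun w hw => by
    by_cases hwz : w = z
    · exact Or.inl hwz
    · exact Or.inr ((hK.joinedAvoiding (hBK.1 hcB) hw hcz hwz).mono K.spanningCoe_le)
  refine ⟨hverts, fun x y hxy => ?_⟩
  rw [hBdef, Subgraph.induce_adj]
  exact ⟨hverts (K.edge_vert hxy), hverts (K.edge_vert hxy.symm), K.adj_sub hxy⟩

theorem isBridge_of_forall_adj {c z : V} (hcz : c ≠ z) (h : ∀ w, G.Adj c w → w = z) : G.IsBridge s(c, z) := by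
  rw [isBridge_iff_forall_walk_mem_edges]
  intro p
  cases p with
  | nil => exact absurd rfl hcz
  | cons hcn p => simp [h _ hcn]

theorem exists_isEndBlock_of_forall_not_isCutVertex [Finite V] (hG : G.Connected) {z c : V}
    (hz : IsCutVertex G z) (hcz : c ≠ z)
    (h : ∀ y, JoinedAvoiding G z c y → ¬ IsCutVertex G y) :
    ∃ B, IsEndBlock G B ∧ ∀ v ∈ B.verts, ¬ IsCutVertex G v → JoinedAvoiding G z c v := by
  suffices ∃ B, IsBlock G B ∧ B.verts = closedComponent G z c by
    obtain ⟨B, hB, hBv⟩ := this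
    refine ⟨B, isEndBlock_iff.2 ⟨hB, z, hBv ▸ Or.inl rfl, hz, fun y hy hyc => ?_⟩,
      fun v hv hvc => ?_⟩
    · rw [hBv] at hy
      exact hy.resolve_right fun hy => h y hy hyc
    · rw [hBv] at hv
      exact hv.resolve_left fun hvz => hvc (hvz ▸ hz)
  by_cases hb : ∃ b, JoinedAvoiding G z c b ∧ c ≠ b
  · obtain ⟨b, hb, hcb⟩ := hb
    exact ⟨_, isBlock_induce_closedComponent hG hcz hb hcb h, rfl⟩
  · push Not at hb
    have hcomp (w : V) (hw : w ∈ closedComponent G z c) : w = z ∨ w = c :=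
      hw.imp_right fun hw => (hb w hw).symm
    have hadj (w : V) (hw : G.Adj c w) : w = z :=
      (hcomp w (mem_closedComponent_of_adj (.refl hcz) hw)).resolve_right hw.ne'
    obtain ⟨p⟩ := hG.preconnected c z
    cases p with
    | nil => exact absurd rfl hcz
    | cons hcn p =>
      obtain rfl := hadj _ hcn
      refine ⟨G.subgraphOfAdj hcn, Or.inl ⟨_, _, hcn, isBridge_of_forall_adj hcz hadj, rfl⟩, ?_⟩
      ext w
      refine ⟨?_, fun hw => (hcomp w hw).symm⟩
      rintro (rfl | rfl)
      · exact Or.inr (.refl hcz)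
      · exact Or.inl rfl

/-- Every component of `G - z`, for a cut vertex `z`, contains the vertices other than cut
vertices of some end block. -/
theorem IsCutVertex.exists_isEndBlock [Finite V] (hG : G.Connected) {z c : V}
    (hz : IsCutVertex G z) (hcz : c ≠ z) :
    ∃ B, IsEndBlock G B ∧ ∀ v ∈ B.verts, ¬ IsCutVertex G v → JoinedAvoiding G z c v := by
  induction hn : {w | JoinedAvoiding G z c w}.ncard using Nat.strong_induction_on
    generalizing z c with
  | _ n ih =>
    subst hn
    by_cases h : ∃ y, JoinedAvoiding G z c y ∧ IsCutVertex G y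
    · obtain ⟨y, hcy, hy⟩ := h
      -- Pass to a component of `G - y` that misses `z`. It lies inside the component of `c` in `G -
      -- z`, properly since it lacks `y`.
      obtain ⟨d, hdy, hd⟩ : ∃ d, d ≠ y ∧ ¬ JoinedAvoiding G y d z := by
        by_contra! hc
        obtain ⟨u, w, hu, hw, huw⟩ := (isCutVertex_iff hG).1 hy
        exact huw ((hc u hu).trans (hc w hw).symm)
      have hdy' : JoinedAvoiding G z d y := joinedAvoiding_of_forall_ne hG
        (fun w hw hwz => hd (hwz ▸ hw)) hdy hcy.ne_right
      have hsub {w : V} (hw : JoinedAvoiding G y d w) : JoinedAvoiding G z c w := by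
        obtain ⟨p, hp⟩ := hw
        exact (hcy.trans hdy'.symm).trans ⟨p, fun hzp => hd (.of_mem_support hp hzp)⟩
      obtain ⟨B, hB, hBd⟩ := ih _ (Set.ncard_lt_ncard ⟨fun w hw => hsub hw, fun hle =>
        JoinedAvoiding.ne_right (hle hcy) rfl⟩) hy hdy rfl
      exact ⟨B, hB, fun v hv hvc => hsub (hBd v hv hvc)⟩
    · push Not at h
      exact exists_isEndBlock_of_forall_not_isCutVertex hG hz hcz h

theorem exists_isIntervalSet_ncard_le [Finite V] (hG : G.Connected) {z : V}
    (hz : IsCutVertex G z) : ∃ S : Set V, IsIntervalSet G S ∧ S.ncard ≤ endBlockNumber G := by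
  have := hG.nonempty
  choose! f hfB hfc using fun (B : G.Subgraph) (hB : IsEndBlock G B) =>
    hB.exists_not_isCutVertex
  refine ⟨f '' {B | IsEndBlock G B}, ?_, Set.ncard_image_le⟩
  set S := f '' {B | IsEndBlock G B} with hS
  have key {z c : V} (hz : IsCutVertex G z) (hcz : c ≠ z) : ∃ s ∈ S, JoinedAvoiding G z c s := by
    obtain ⟨B, hB, h⟩ := hz.exists_isEndBlock hG hcz
    exact ⟨f B, ⟨B, hB, rfl⟩, h _ (hfB B hB) (hfc B hB)⟩
  refine Set.eq_univ_of_forall fun v => ?_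
  by_cases hv : v ∈ S
  · exact Or.inl hv
  obtain ⟨u, w, hu, hw, huw⟩ := (isCutVertex_iff hG).1 hz
  obtain ⟨s, hs, hus⟩ := key hz hu
  obtain ⟨t, ht, hwt⟩ := key hz hw
  -- Two members of `S` on different sides of `z`: if `x` is not a cut vertex, one of them differs
  -- from `x` and serves as the target.
  have hst : s ≠ t := by
    rintro rfl
    exact huw (hus.trans hwt.symm)
  obtain ⟨a, ha, b, hb, -, hf⟩ := exists_fan hv ⟨s, hs⟩ (fun s _ => hG.preconnected v s)
    fun x hxv => by
      by_cases hx : IsCutVertex G x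
      · exact key hx hxv.symm
      by_cases hsx : s = x
      · exact ⟨t, ht, joinedAvoiding_of_not_isCutVertex hG hx hxv.symm (hsx ▸ hst.symm)⟩
      · exact ⟨s, hs, joinedAvoiding_of_not_isCutVertex hG hx hxv.symm hsx⟩
  obtain ⟨p, hp, hvp⟩ := hf.exists_isPath
  exact Or.inr ⟨a, ha, b, hb, p, hp, hvp⟩

/-! ### The small cases and the conclusion -/

theorem intervalNumber_eq {n : ℕ} (h : ∃ S, IsIntervalSet G S ∧ S.ncard ≤ n)
    (h' : ∀ S, IsIntervalSet G S → n ≤ S.ncard) : intervalNumber G = n := by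
  obtain ⟨S, hS, hn⟩ := h
  refine le_antisymm (le_trans (Nat.sInf_le (m := S.ncard) ⟨S, hS, rfl⟩) hn)
    (le_csInf ⟨S.ncard, S, hS, rfl⟩ ?_)
  rintro _ ⟨T, hT, rfl⟩
  exact h' T hT

theorem IsIntervalSet.one_le_ncard [Finite V] [Nonempty V] {S : Set V} (hS : IsIntervalSet G S) :
    1 ≤ S.ncard := by
  rw [Nat.one_le_iff_ne_zero, Ne, Set.ncard_eq_zero]
  rintro rfl
  have : (Set.univ : Set V) = ∅ := by rw [← hS]; simp [interval]
  exact Set.univ_nonempty.ne_empty this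

theorem IsIntervalSet.two_le_ncard [Finite V] [Nontrivial V] {S : Set V}
    (hS : IsIntervalSet G S) : 2 ≤ S.ncard := by
  refine lt_of_le_of_ne hS.one_le_ncard fun h => ?_
  obtain ⟨s, rfl⟩ := Set.ncard_eq_one.1 h.symm
  obtain ⟨v, hv⟩ := exists_ne s
  have : v ∈ interval G {s} := hS ▸ Set.mem_univ v
  rcases this with h | ⟨u, rfl, w, rfl, p, hp, hvp⟩
  · exact hv h
  · have hnil := Walk.isPath_iff_nil.1 hp
    rw [Walk.nil_iff_support_eq.1 hnil, List.mem_singleton] at hvp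
    exact hv hvp

theorem isIntervalSet_univ : IsIntervalSet G Set.univ := by
  simp [IsIntervalSet, interval]

theorem TwoConnected.exists_isIntervalSet [Finite V] (h : TwoConnected G) :
    ∃ S, IsIntervalSet G S ∧ S.ncard ≤ 2 := by
  have hj := (twoConnected_iff.1 h).2
  have : Nontrivial V := Finite.one_lt_card_iff_nontrivial.1 (by have := h.1; omega)
  obtain ⟨a, b, hab⟩ := exists_pair_ne V
  refine ⟨{a, b}, Set.eq_univ_of_forall fun v => ?_, (Set.ncard_pair hab).le⟩
  by_cases hv : v ∈ ({a, b} : Set V)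
  · exact Or.inl hv
  · simp only [Set.mem_insert_iff, Set.mem_singleton_iff, not_or] at hv
    obtain ⟨p, hp, hvp⟩ := exists_isPath_of_forall_joinedAvoiding hab hv.1 hv.2
      (fun x hxv hxa => hj x v a hxv.symm hxa.symm) (hj a v b hv.1 hab.symm)
    exact Or.inr ⟨a, by simp, b, by simp, p, hp, hvp⟩

theorem exists_isCutVertex [Finite V] (hG : G.Connected)
    (h : ¬ (Nat.card V = 1 ∨ Nat.card V = 2 ∨ TwoConnected G)) : ∃ z, IsCutVertex G z := by
  by_contra! hc
  have := hG.nonempty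
  have hpos : 0 < Nat.card V := Nat.card_pos
  refine h ?_
  by_cases h3 : 3 ≤ Nat.card V
  · exact Or.inr (Or.inr (twoConnected_iff.2 ⟨h3, fun x u w hu hw =>
      joinedAvoiding_of_not_isCutVertex hG (hc x) hu hw⟩))
  · omega

end AllPath

theorem mainTheorem5 {V : Type*} [Finite V] (G : SimpleGraph V) (hG : G.Connected) :
    (Nat.card V = 1 → AllPath.intervalNumber G = 1) ∧
    (Nat.card V = 2 ∨ AllPath.TwoConnected G → AllPath.intervalNumber G = 2) ∧
    (¬ (Nat.card V = 1 ∨ Nat.card V = 2 ∨ AllPath.TwoConnected G) →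
      AllPath.intervalNumber G = AllPath.endBlockNumber G) := by
  have := hG.nonempty
  refine ⟨fun h => ?_, fun h => ?_, fun h => ?_⟩
  · exact AllPath.intervalNumber_eq ⟨_, AllPath.isIntervalSet_univ, by rw [Set.ncard_univ, h]⟩
      fun S hS => hS.one_le_ncard
  · have : Nontrivial V := Finite.one_lt_card_iff_nontrivial.1 (by
      rcases h with h | h
      · omega
      · have := h.1
        omega)
    refine AllPath.intervalNumber_eq ?_ fun S hS => hS.two_le_ncard
    rcases h with h | h
    · exact ⟨_, AllPath.isIntervalSet_univ, by rw [Set.ncard_univ, h]⟩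
    · exact h.exists_isIntervalSet
  · obtain ⟨z, hz⟩ := AllPath.exists_isCutVertex hG h
    exact AllPath.intervalNumber_eq (AllPath.exists_isIntervalSet_ncard_le hG hz)
      fun S hS => AllPath.endBlockNumber_le_ncard hG hS
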